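/- Let $\mathbb D$ be the open unit disk in $\mathbb C$ and let $\mathcal V_0 = \{z \in \mathbb D^3 : z_3 = z_1 + z_2\}$. A set $\mathcal V \subseteq \mathbb D^3$ has the \emph{polynomial extension property} if for every polynomial $p \in \mathbb C[z_1,z_2,z_3]$ there is a bounded holomorphic function $\phi$ on $\mathbb D^3$ with $\phi|_{\mathcal V} = p|_{\mathcal V}$ and $\sup_{\mathbb D^3}|\phi| = \sup_{\mathcal V}|p|$. 1. $\mathcal V_0$ does not have the polynomial extension property. 2. $\mathcal V_0$ is a holomorphic graph over every pair of coordinates: for each $r \in \{1,2,3\}$ there are a domain $U_r \subseteq \mathbb D^2$ and a holomorphic function $h_r : U_r \to \mathbb D$ such that $$\mathcal V_0 = \{(z_1,z_2,h_3(z_1,z_2)) : (z_1,z_2)\in U_3\} = \{(z_1,h_2(z_1,z_3),z_3) : (z_1,z_3)\in U_2\} = \{(h_1(z_2,z_3),z_2,z_3) : (z_2,z_3)\in U_1\}.$$ 3. For $x \in \mathbb D^3$ let $\Phi_x(z) = (m_{x_1}(z_1), m_{x_2}(z_2), m_{x_3}(z_3))$, where $m_a(\zeta) = \frac{a-\zeta}{1-\bar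 a\zeta}$; this is an involutive automorphism of $\mathbb D^3$ that interchanges $0$ and $x$. For $x \in \mathcal V_0$, there exist two different pairs of unimodular constants $(\omega_1,\eta_1) \ne (\omega_2,\eta_2)$ such that both balanced disks $\{(\zeta, \omega_i\zeta, \eta_i\zeta) : \zeta\in\mathbb D\}$, $i=1,2$, are contained in $\Phi_x(\mathcal V_0)$ if and only if $x = 0$. In particular, since $\Phi_0(\mathcal V_0) = -\mathcal V_0 = \mathcal V_0$, the surface $\mathcal V_0$ itself contains two such balanced disks through the origin. -/

import Mathlib

/-- The open unit polydisk `𝔻^d` in `ℂ^d`. -/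
def unitPolydisk (d : ℕ) : Set (Fin d → ℂ) := {z | ∀ j, ‖z j‖ < 1}

/-- The supremum norm of `f` over the set `S` (used only for `f` bounded on `S`). -/
noncomputable def supNormOn {d : ℕ} (S : Set (Fin d → ℂ)) (f : (Fin d → ℂ) → ℂ) : ℝ :=
  ⨆ z : S, ‖f z‖

/-- `φ` restricts to a bounded holomorphic function on the open set `Ω`, i.e. `φ|_Ω ∈ H^∞(Ω)`. -/
def IsBoundedHolomorphicOn {d : ℕ} (φ : (Fin d → ℂ) → ℂ) (Ω : Set (Fin d → ℂ)) : Prop :=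
  DifferentiableOn ℂ φ Ω ∧ ∃ C : ℝ, ∀ z ∈ Ω, ‖φ z‖ ≤ C

/-- The polynomial extension property of a subset `V` of a bounded domain `Ω` of `ℂ^d`: for every
polynomial `p` there is `φ ∈ H^∞(Ω)` with `φ|_V = p|_V` whose supremum norm over `Ω` equals the
supremum norm of `p` over `V`. -/
def HasPolynomialExtensionProperty {d : ℕ} (Ω V : Set (Fin d → ℂ)) : Prop :=
  ∀ p : MvPolynomial (Fin d) ℂ, ∃ φ : (Fin d → ℂ) → ℂ,
    IsBoundedHolomorphicOn φ Ω ∧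
    (∀ z ∈ V, φ z = MvPolynomial.eval z p) ∧
    supNormOn Ω φ = supNormOn V (fun z => MvPolynomial.eval z p)

/-- `V` is the graph of a holomorphic function `h : U → 𝔻`, on a domain `U ⊆ 𝔻²`, that expresses
the `r`-th coordinate through the two other ones (taken in increasing order). -/
def IsHolomorphicGraphInCoordinate (V : Set (Fin 3 → ℂ)) (r : Fin 3) : Prop :=
  ∃ (U : Set (Fin 2 → ℂ)) (h : (Fin 2 → ℂ) → ℂ),
    U ⊆ unitPolydisk 2 ∧ IsOpen U ∧ IsConnected U ∧
    DifferentiableOn ℂ h U ∧ (∀ w ∈ U, ‖h w‖ < 1) ∧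
    V = {z | ∃ w ∈ U, z = Fin.insertNth (α := fun _ => ℂ) r (h w) w}

/-- The involutive Möbius map `m_a(ζ) = (a - ζ) / (1 - ā ζ)` of the disk, swapping `0` and `a`. -/
noncomputable def moebiusInvolution (a ζ : ℂ) : ℂ := (a - ζ) / (1 - star a * ζ)

/-- The involutive automorphism `(m_{x₁}, m_{x₂}, m_{x₃})` of `𝔻³`, swapping `0` and `x`. -/
noncomputable def polydiskInvolution (x z : Fin 3 → ℂ) : Fin 3 → ℂ :=
  fun j => moebiusInvolution (x j) (z j)

/-- The balanced disk `{(ζ, ωζ, ηζ) : ζ ∈ 𝔻}`. -/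
def balancedDisk (ω η : ℂ) : Set (Fin 3 → ℂ) := {z | ∃ ζ : ℂ, ‖ζ‖ < 1 ∧ z = ![ζ, ω * ζ, η * ζ]}

/-- The image of `V` under the involution swapping `0` and `x` contains the balanced disks of two
different pairs of unimodular constants. -/
def HasTwoBalancedDisksAt (V : Set (Fin 3 → ℂ)) (x : Fin 3 → ℂ) : Prop :=
  ∃ ω₁ η₁ ω₂ η₂ : ℂ, ‖ω₁‖ = 1 ∧ ‖η₁‖ = 1 ∧ ‖ω₂‖ = 1 ∧ ‖η₂‖ = 1 ∧ (ω₁, η₁) ≠ (ω₂, η₂) ∧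
    balancedDisk ω₁ η₁ ⊆ polydiskInvolution x '' V ∧
    balancedDisk ω₂ η₂ ⊆ polydiskInvolution x '' V

/-- The surface `{z ∈ 𝔻³ : z₃ = z₁ + z₂}`. -/
def sumSurface : Set (Fin 3 → ℂ) := {z | z ∈ unitPolydisk 3 ∧ z 2 = z 0 + z 1}

/-!
Let `p = z₁ z₂ - z₃²`. On the surface `p = -(z₁² + z₁ z₂ + z₂²)`, and this has modulus at most `1`
whenever `‖z₁‖, ‖z₂‖, ‖z₁ + z₂‖ ≤ 1` (`norm_sq_add_mul_add_sq_le_one`). Suppose that a holomorphic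
`φ` on the polydisk with `‖φ‖ ≤ 1` agrees with `p` on the surface. The second derivative of
`ζ ↦ φ (ζ w)` at `0` is a quadratic form `Q` in `w` (`exists_bilinForm_iteratedDeriv_two`), Cauchy's
estimate gives `‖Q w‖ ≤ 2` for `w` in the closed polydisk, and `Q w = 2 p(w)` for `w` in the plane
`z₃ = z₁ + z₂`, so `Q = -2` at `(1, -1, 0)`, `(1, 0, 1)` and `(0, 1, 1)`. The linear relation
`bilinForm_apply_self_sum_eq` among values of a quadratic form then reads
`Q(1, 1, 1) + Q(1, -1, -1) + Q(-1, 1, -1) = Q(1, 1, -1) / 3 - 8`, which contradicts the bounds on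
`Q`. The fact about holomorphic functions of several variables behind this is that their
directional derivatives are holomorphic (`differentiableAt_fderiv_apply`).

The surface is linear, hence a graph over each pair of coordinates, on a convex domain.

The image under the involution at `x` contains the balanced disk of `(ω, η)` only if
`m_{x₃}(ηζ) = m_{x₁}(ζ) + m_{x₂}(ωζ)` on the unit disk. Each of the three terms is a constant plus a
nonzero multiple of `ζ / (1 - sζ)`, where `s` is `x̄₃η`, `x̄₁`, `x̄₂ω` respectively, and such
fractions with nonzero coefficients can only cancel if the three values of `s` coincide
(`eq_and_eq_of_sum_div_eq_zero`). So `x₂ = ωx₁` and `x₃ = ηx₁`, and the pair `(ω, η)` is unique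
unless `x = 0`. For `x = 0` the two primitive cube roots of unity `ω`, with `η = 1 + ω`, give two
disks.
-/

/-! ### Second derivatives of holomorphic functions of several variables -/

open Metric MeasureTheory Filter Topology Complex in
/-- Directional derivatives of a holomorphic function on a finite-dimensional space are again
holomorphic. The derivative in direction `v` at `z` is a Cauchy integral of `f` over a circle in
`z + ℂ v`, and that integral can be differentiated in `z` because the Schwarz lemma bounds
`fderiv ℂ f` locally. -/
theorem differentiableAt_fderiv_apply {E : Type*} [NormedAddCommGroup E] [NormedSpace ℂ E]
    [FiniteDimensional ℂ E] {f : E → ℂ} {s : Set E} (hs : IsOpen s)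
    (hf : DifferentiableOn ℂ f s) {x : E} (hx : x ∈ s) (v : E) :
    DifferentiableAt ℂ (fun z => fderiv ℂ f z v) x := by
  borelize E
  obtain ⟨M, ε, hε, hsub, hM⟩ : ∃ M ε : ℝ, 0 < ε ∧ ball x (4 * ε) ⊆ s ∧
      ∀ y ∈ ball x (4 * ε), ‖f y‖ ≤ M := by
    have hc : ContinuousAt f x := (hf.differentiableAt (hs.mem_nhds hx)).continuousAt
    have hnear : {y | ‖f y‖ < ‖f x‖ + 1} ∈ 𝓝 x :=
      hc.norm.eventually (gt_mem_nhds (lt_add_one _))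
    obtain ⟨δ, hδ, hball⟩ := Metric.mem_nhds_iff.1 (inter_mem (hs.mem_nhds hx) hnear)
    have h4 : 4 * (δ / 4) = δ := by ring
    exact ⟨‖f x‖ + 1, δ / 4, by positivity, by rw [h4]; exact fun y hy => (hball hy).1,
      by rw [h4]; exact fun y hy => (hball hy).2.le⟩
  have hd : ∀ y ∈ ball x (4 * ε), DifferentiableAt ℂ f y := fun y hy =>
    hf.differentiableAt (hs.mem_nhds (hsub hy))
  have hnorm : ∀ y ∈ ball x (2 * ε), ‖fderiv ℂ f y‖ ≤ 2 * M / ε := by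
    intro y hy
    have hyx : ball y ε ⊆ ball x (4 * ε) := by
      intro u hu
      rw [mem_ball] at *
      linarith [dist_triangle u y x]
    refine norm_fderiv_le_div_of_mapsTo_ball (hf.mono (hyx.trans hsub)) ?_ hε
    intro u hu
    rw [mem_closedBall, dist_eq_norm]
    linarith [norm_sub_le (f u) (f y), hM u (hyx hu), hM y (hyx (mem_ball_self hε))]
  obtain ⟨c, hc, hcv⟩ : ∃ c : ℝ, 0 < c ∧ c * ‖v‖ < ε := by
    refine ⟨ε / (‖v‖ + 1), by positivity, ?_⟩
    rw [div_mul_eq_mul_div, div_lt_iff₀ (by positivity)]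
    nlinarith
  have hmem : ∀ z ∈ ball x ε, ∀ ζ : ℂ, ‖ζ‖ ≤ c → z + ζ • v ∈ ball x (2 * ε) := by
    intro z hz ζ hζ
    rw [mem_ball, dist_eq_norm] at *
    have h1 : ‖ζ • v‖ ≤ c * ‖v‖ := by
      rw [norm_smul]; gcongr
    calc ‖z + ζ • v - x‖ = ‖(z - x) + ζ • v‖ := by congr 1; abel
      _ ≤ ‖z - x‖ + ‖ζ • v‖ := norm_add_le _ _
      _ < 2 * ε := by linarith
  have hmono : ball x (2 * ε) ⊆ ball x (4 * ε) := ball_subset_ball (by linarith)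
  have hcirc : ∀ t : ℝ, ‖circleMap 0 c t‖ ≤ c := fun t => by simp [abs_of_pos hc]
  set k : ℝ → ℂ := fun t => deriv (circleMap 0 c) t * (1 / (circleMap 0 c t - 0) ^ 2) with hk
  have hkc : Continuous k := by
    have hne : ∀ t, (circleMap 0 c t - 0) ^ 2 ≠ 0 := fun t => by
      simp [circleMap_eq_center_iff, hc.ne']
    simp only [hk, deriv_circleMap]
    exact ((continuous_circleMap 0 c).mul continuous_const).mul
      (continuous_const.div (((continuous_circleMap 0 c).sub continuous_const).pow 2) hne)
  have hcauchy : ∀ z ∈ ball x ε, fderiv ℂ f z v =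
      (2 * Real.pi * I)⁻¹ * ∫ t in (0 : ℝ)..2 * Real.pi, k t * f (z + circleMap 0 c t • v) := by
    intro z hz
    have hline : ∀ ζ : ℂ, ‖ζ‖ ≤ c → HasDerivAt (fun ζ : ℂ => f (z + ζ • v))
        (fderiv ℂ f (z + ζ • v) v) ζ := by
      intro ζ hζ
      have h1 : HasDerivAt (fun ζ : ℂ => z + ζ • v) v ζ := by
        simpa using ((hasDerivAt_id ζ).smul_const v).const_add z
      exact (hd _ (hmono (hmem z hz ζ hζ))).hasFDerivAt.comp_hasDerivAt ζ h1
    have h2 := DifferentiableOn.deriv_eq_smul_circleIntegral (c := 0)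
      (f := fun ζ : ℂ => f (z + ζ • v)) hc (fun ζ hζ =>
        (hline ζ (by simpa using hζ)).differentiableAt.differentiableWithinAt)
    have h3 := (hline 0 (by simpa using hc.le)).deriv
    rw [zero_smul, add_zero] at h3
    rw [h3, circleIntegral] at h2
    rw [eq_inv_mul_iff_mul_eq₀ (by simp [Real.pi_ne_zero]), ← smul_eq_mul, ← h2]
    simp only [smul_eq_mul, hk, mul_assoc]
  have hcont : ∀ z ∈ ball x ε, Continuous fun t : ℝ => f (z + circleMap 0 c t • v) := by
    intro z hz
    refine ContinuousOn.comp_continuous (s := ball x (2 * ε))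
      (fun y hy => (hd y (hmono hy)).continuousAt.continuousWithinAt)
      (continuous_const.add ((continuous_circleMap 0 c).smul continuous_const)) ?_
    exact fun t => hmem z hz _ (hcirc t)
  have hint : DifferentiableAt ℂ
      (fun z => ∫ t in (0 : ℝ)..2 * Real.pi, k t * f (z + circleMap 0 c t • v)) x := by
    refine (intervalIntegral.hasFDerivAt_integral_of_dominated_of_fderiv_le (μ := volume)
      (F' := fun z t => k t • fderiv ℂ f (z + circleMap 0 c t • v))
      (bound := fun t => ‖k t‖ * (2 * M / ε)) (ball_mem_nhds x hε)
      ?_ ?_ ?_ ?_ ?_ ?_).differentiableAt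
    · filter_upwards [ball_mem_nhds x hε] with z hz
      exact (hkc.mul (hcont z hz)).aestronglyMeasurable
    · exact (hkc.mul (hcont x (mem_ball_self hε))).intervalIntegrable _ _
    · refine hkc.aestronglyMeasurable.smul (Measurable.aestronglyMeasurable ?_)
      exact (measurable_fderiv ℂ f).comp
        (continuous_const.add ((continuous_circleMap 0 c).smul continuous_const)).measurable
    · refine Eventually.of_forall fun t _ z hz => ?_
      rw [norm_smul]
      gcongr
      exact hnorm _ (hmem z hz _ (hcirc t))
    · exact (hkc.norm.mul continuous_const).intervalIntegrable _ _
    · refine Eventually.of_forall fun t _ z hz => ?_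
      have h1 := (hd _ (hmono (hmem z hz _ (hcirc t)))).hasFDerivAt
      exact ((hasFDerivAt_comp_add_right _).2 h1).const_mul (k t)
  refine (hint.const_mul (2 * Real.pi * I)⁻¹).congr_of_eventuallyEq ?_
  filter_upwards [ball_mem_nhds x hε] with z hz using hcauchy z hz

open Filter Topology in
/-- The second derivative at `0` of a holomorphic function along the complex line through `w` is a
quadratic form in `w`. -/
theorem exists_bilinForm_iteratedDeriv_two {E : Type*} [NormedAddCommGroup E] [NormedSpace ℂ E]
    [FiniteDimensional ℂ E] {f : E → ℂ} {s : Set E} (hs : IsOpen s)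
    (hf : DifferentiableOn ℂ f s) (h0 : (0 : E) ∈ s) :
    ∃ B : LinearMap.BilinForm ℂ E, ∀ w,
      iteratedDeriv 2 (fun ζ : ℂ => f (ζ • w)) 0 = B w w := by
  have hd := fun v => differentiableAt_fderiv_apply hs hf h0 v
  -- No symmetry of the second derivative is needed, only its values on the diagonal.
  refine ⟨LinearMap.mk₂ ℂ (fun u v => fderiv ℂ (fun z => fderiv ℂ f z v) 0 u)
    (fun _ _ _ => map_add _ _ _) (fun _ _ _ => map_smul _ _ _) ?_ ?_, fun w => ?_⟩
  · intro u v w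
    simp only [map_add]
    rw [fderiv_fun_add (hd v) (hd w), add_apply]
  · intro c u v
    simp only [map_smul]
    rw [fderiv_fun_const_smul (hd v), smul_apply]
  have hray : ∀ ζ : ℂ, HasDerivAt (fun ζ : ℂ => ζ • w) w ζ := fun ζ => by
    simpa using (hasDerivAt_id ζ).smul_const w
  have hfirst : deriv (fun ζ : ℂ => f (ζ • w)) =ᶠ[𝓝 0] fun ζ => fderiv ℂ f (ζ • w) w := by
    have hnear : ∀ᶠ ζ : ℂ in 𝓝 0, ζ • w ∈ s :=
      (hray 0).continuousAt.eventually_mem (by simpa using hs.mem_nhds h0)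
    filter_upwards [hnear] with ζ hζ
    exact ((hf.differentiableAt (hs.mem_nhds hζ)).hasFDerivAt.comp_hasDerivAt ζ (hray ζ)).deriv
  have hsecond : HasFDerivAt (fun z => fderiv ℂ f z w) (fderiv ℂ (fun z => fderiv ℂ f z w) 0)
      ((0 : ℂ) • w) := by
    rw [zero_smul]
    exact (hd w).hasFDerivAt
  rw [iteratedDeriv_succ, iteratedDeriv_one, hfirst.deriv_eq]
  exact (hsecond.comp_hasDerivAt 0 (hray 0)).deriv

open Metric Filter Topology in
theorem norm_iteratedDeriv_two_le {f : ℂ → ℂ} (hf : DifferentiableOn ℂ f (ball 0 1)) {C : ℝ}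
    (hC : ∀ ζ ∈ ball (0 : ℂ) 1, ‖f ζ‖ ≤ C) : ‖iteratedDeriv 2 f 0‖ ≤ 2 * C := by
  -- Cauchy's estimate on the circle of radius `R < 1` loses a factor `R ^ 2`; let `R → 1`.
  have hlim : Tendsto (fun R : ℝ => ‖iteratedDeriv 2 f 0‖ * R ^ 2) (𝓝[<] 1)
      (𝓝 (‖iteratedDeriv 2 f 0‖ * 1 ^ 2)) :=
    ((continuous_const.mul (continuous_id.pow 2)).tendsto 1).mono_left nhdsWithin_le_nhds
  rw [one_pow, mul_one] at hlim
  refine le_of_tendsto hlim ?_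
  filter_upwards [Ioo_mem_nhdsLT (zero_lt_one' ℝ)] with R hR
  have hsub : closedBall (0 : ℂ) R ⊆ ball 0 1 := closedBall_subset_ball hR.2
  have h := Complex.norm_iteratedDeriv_le_of_forall_mem_sphere_norm_le 2 hR.1
    (hf.mono (closure_ball_subset_closedBall.trans hsub)).diffContOnCl
    fun ζ hζ => hC ζ (hsub (sphere_subset_closedBall hζ))
  rw [le_div_iff₀ (pow_pos hR.1 2)] at h
  simpa using h

/-! ### Failure of the polynomial extension property -/

theorem unitPolydisk_eq_ball (d : ℕ) : unitPolydisk d = Metric.ball 0 1 := by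
  ext z
  simp [unitPolydisk, pi_norm_lt_iff]

/-- With `X = ‖a‖²`, `Y = ‖b‖²`, `Z = ‖a + b‖²`, the square of the left-hand side is
`X² + Y² + Z² - XY - XZ - YZ`, which is at most `1` on the unit cube. -/
theorem norm_sq_add_mul_add_sq_le_one {a b : ℂ} (ha : ‖a‖ ≤ 1) (hb : ‖b‖ ≤ 1)
    (hab : ‖a + b‖ ≤ 1) : ‖a ^ 2 + a * b + b ^ 2‖ ≤ 1 := by
  have hX := Complex.normSq_eq_norm_sq a
  have hY := Complex.normSq_eq_norm_sq b
  have hZ := Complex.normSq_eq_norm_sq (a + b)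
  have hW := Complex.normSq_eq_norm_sq (a ^ 2 + a * b + b ^ 2)
  have key : Complex.normSq (a ^ 2 + a * b + b ^ 2) =
      Complex.normSq a ^ 2 + Complex.normSq b ^ 2 + Complex.normSq (a + b) ^ 2
        - Complex.normSq a * Complex.normSq b - Complex.normSq a * Complex.normSq (a + b)
        - Complex.normSq b * Complex.normSq (a + b) := by
    simp only [Complex.normSq_apply, pow_two, Complex.add_re, Complex.add_im, Complex.mul_re,
      Complex.mul_im]
    ring
  rw [hX, hY, hZ, hW] at key
  have hX1 : ‖a‖ ^ 2 ≤ 1 := pow_le_one₀ (norm_nonneg _) ha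
  have hY1 : ‖b‖ ^ 2 ≤ 1 := pow_le_one₀ (norm_nonneg _) hb
  have hZ1 : ‖a + b‖ ^ 2 ≤ 1 := pow_le_one₀ (norm_nonneg _) hab
  -- For `Z ≤ Y ≤ X` the left-hand side is `(X - Z)² - (X - Y) (Y - Z)`.
  have hquad : ∀ X Y Z : ℝ, 0 ≤ Z → Z ≤ Y → Y ≤ X → X ≤ 1 →
      X ^ 2 + Y ^ 2 + Z ^ 2 - X * Y - X * Z - Y * Z ≤ 1 := by
    intro X Y Z hZ hZY hYX hX
    nlinarith [mul_nonneg (sub_nonneg.2 hZY) (sub_nonneg.2 hYX)]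
  have hX0 : 0 ≤ ‖a‖ ^ 2 := by positivity
  have hY0 : 0 ≤ ‖b‖ ^ 2 := by positivity
  have hZ0 : 0 ≤ ‖a + b‖ ^ 2 := by positivity
  rw [← sq_le_one_iff₀ (norm_nonneg _), key]
  generalize ‖a‖ ^ 2 = X at *
  generalize ‖b‖ ^ 2 = Y at *
  generalize ‖a + b‖ ^ 2 = Z at *
  rcases le_total X Y with h1 | h1 <;> rcases le_total Y Z with h2 | h2 <;>
    rcases le_total X Z with h3 | h3
  · linarith [hquad Z Y X hX0 h1 h2 hZ1]
  · linarith [hquad Z Y X hX0 h1 h2 hZ1]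
  · linarith [hquad Y Z X hX0 h3 h2 hY1]
  · linarith [hquad Y X Z hZ0 h3 h1 hY1]
  · linarith [hquad Z X Y hY0 h1 h3 hZ1]
  · linarith [hquad X Z Y hY0 h2 h3 hX1]
  · linarith [hquad X Y Z hZ0 h2 h1 hX1]
  · linarith [hquad X Y Z hZ0 h2 h1 hX1]

/-- An identity for quadratic forms on `ℂ³` that relates four vertices of the cube to three vectors
of the plane `z₃ = z₁ + z₂`. The bilinear form need not be symmetric. -/
theorem bilinForm_apply_self_sum_eq (B : LinearMap.BilinForm ℂ (Fin 3 → ℂ)) :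
    B ![1, 1, 1] ![1, 1, 1] + B ![1, -1, -1] ![1, -1, -1] + B ![-1, 1, -1] ![-1, 1, -1] =
      1 / 3 * B ![1, 1, -1] ![1, 1, -1] + 4 / 3 *
        (B ![1, -1, 0] ![1, -1, 0] + B ![1, 0, 1] ![1, 0, 1] + B ![0, 1, 1] ![0, 1, 1]) := by
  obtain ⟨b, hb⟩ : ∃ b : Fin 3 → Fin 3 → ℂ, ∀ u, B u u = ∑ i, ∑ j, u i * (u j * b i j) := by
    refine ⟨fun i j => B (Pi.single j 1) (Pi.single i 1), fun u => ?_⟩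
    have hu : u = ∑ i, u i • (Pi.single i 1 : Fin 3 → ℂ) := by
      ext j
      simp [Finset.sum_apply, Pi.single_apply]
    conv_lhs => rw [hu]
    simp only [map_sum, LinearMap.sum_apply, map_smul, LinearMap.smul_apply, smul_eq_mul,
      Finset.mul_sum]
  simp only [hb, Fin.sum_univ_three, Matrix.cons_val_zero, Matrix.cons_val_one, Matrix.cons_val]
  ring

open Metric in
/-- The polynomial `z₁ z₂ - z₃²` has supremum norm at most `1` on the surface and no extension to
the polydisk of norm at most `1`. -/
theorem not_hasPolynomialExtensionProperty_sumSurface :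
    ¬ HasPolynomialExtensionProperty (unitPolydisk 3) sumSurface := by
  intro h
  obtain ⟨φ, ⟨hφ, C, hC⟩, hext, hsup⟩ :=
    h (MvPolynomial.X 0 * MvPolynomial.X 1 - MvPolynomial.X 2 ^ 2)
  simp only [map_sub, map_mul, map_pow, MvPolynomial.eval_X] at hext hsup
  have hle : ∀ z ∈ unitPolydisk 3, ‖φ z‖ ≤ 1 := by
    intro z hz
    have h1 : ‖φ z‖ ≤ supNormOn (unitPolydisk 3) φ :=
      le_ciSup (f := fun z : unitPolydisk 3 => ‖φ z‖)
        ⟨C, by rintro _ ⟨w, rfl⟩; exact hC w w.2⟩ ⟨z, hz⟩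
    refine h1.trans (hsup.trans_le (Real.iSup_le ?_ zero_le_one))
    rintro ⟨w, hw, hw2⟩
    have h2 : ‖w 0 + w 1‖ ≤ 1 := hw2 ▸ (hw 2).le
    have h3 : w 0 * w 1 - w 2 ^ 2 = -(w 0 ^ 2 + w 0 * w 1 + w 1 ^ 2) := by rw [hw2]; ring
    simpa only [h3, norm_neg] using norm_sq_add_mul_add_sq_le_one (hw 0).le (hw 1).le h2
  have hscale : ∀ w : Fin 3 → ℂ, (∀ j, ‖w j‖ ≤ 1) → ∀ ζ ∈ ball (0 : ℂ) 1,
      ζ • w ∈ unitPolydisk 3 := by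
    intro w hw ζ hζ j
    rw [mem_ball_zero_iff] at hζ
    rw [Pi.smul_apply, smul_eq_mul, norm_mul]
    exact (mul_le_of_le_one_right (norm_nonneg _) (hw j)).trans_lt hζ
  have hopen : IsOpen (unitPolydisk 3) := by
    rw [unitPolydisk_eq_ball]
    exact isOpen_ball
  obtain ⟨B, hB⟩ := exists_bilinForm_iteratedDeriv_two hopen hφ (by simp [unitPolydisk])
  have hbound : ∀ w : Fin 3 → ℂ, (∀ j, ‖w j‖ ≤ 1) → ‖B w w‖ ≤ 2 := by
    intro w hw
    rw [← hB w, ← mul_one (2 : ℝ)]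
    refine norm_iteratedDeriv_two_le (hφ.comp ?_ (hscale w hw)) fun ζ hζ => hle _ (hscale w hw ζ hζ)
    exact (differentiable_id.smul_const w).differentiableOn
  have hval : ∀ w : Fin 3 → ℂ, (∀ j, ‖w j‖ ≤ 1) → w 2 = w 0 + w 1 →
      w 0 * w 1 - w 2 ^ 2 = -1 → B w w = -2 := by
    intro w hw hsum hp
    have hloc : (fun ζ : ℂ => φ (ζ • w)) =ᶠ[nhds 0] fun ζ => -ζ ^ 2 := by
      filter_upwards [ball_mem_nhds (0 : ℂ) one_pos] with ζ hζ
      rw [hext _ ⟨hscale w hw ζ hζ, by simp [hsum, mul_add]⟩]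
      simp only [Pi.smul_apply, smul_eq_mul]
      linear_combination ζ ^ 2 * hp
    rw [← hB w, hloc.iteratedDeriv_eq 2, iteratedDeriv_fun_neg]
    simp
  -- The left-hand side of the identity has modulus at most `6`, but the right-hand side has real
  -- part at most `2 / 3 - 8`.
  have hid := bilinForm_apply_self_sum_eq B
  rw [hval ![1, -1, 0] (by simp [Fin.forall_fin_succ]) (by simp) (by simp),
    hval ![1, 0, 1] (by simp [Fin.forall_fin_succ]) (by simp) (by simp),
    hval ![0, 1, 1] (by simp [Fin.forall_fin_succ]) (by simp) (by simp)] at hid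
  have hre := congrArg Complex.re hid
  norm_num at hre
  have hre_ge := fun w hw => (abs_le.1 ((Complex.abs_re_le_norm _).trans (hbound w hw))).1
  have h1 := hre_ge ![1, 1, 1] (by simp [Fin.forall_fin_succ])
  have h2 := hre_ge ![1, -1, -1] (by simp [Fin.forall_fin_succ])
  have h3 := hre_ge ![-1, 1, -1] (by simp [Fin.forall_fin_succ])
  have h4 := (Complex.re_le_norm _).trans (hbound ![1, 1, -1] (by simp [Fin.forall_fin_succ]))
  linarith

/-! ### The surface as a graph over each pair of coordinates -/

theorem isHolomorphicGraphInCoordinate_of_linear {V : Set (Fin 3 → ℂ)} {r : Fin 3}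
    (L : (Fin 2 → ℂ) →ₗ[ℂ] ℂ)
    (hV : V = {z | z ∈ unitPolydisk 3 ∧ z r = L (r.removeNth z)}) :
    IsHolomorphicGraphInCoordinate V r := by
  have hL : Continuous L := L.continuous_of_finiteDimensional
  have hU : unitPolydisk 2 ∩ {w | ‖L w‖ < 1} = Metric.ball 0 1 ∩ L ⁻¹' Metric.ball 0 1 := by
    rw [unitPolydisk_eq_ball]
    ext w
    simp
  refine ⟨unitPolydisk 2 ∩ {w | ‖L w‖ < 1}, L, Set.inter_subset_left, ?_, ?_, ?_, fun w hw => hw.2,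
    ?_⟩
  · rw [hU]
    exact Metric.isOpen_ball.inter (Metric.isOpen_ball.preimage hL)
  · rw [hU]
    refine ⟨⟨0, by simp⟩, Convex.isPreconnected ?_⟩
    exact (convex_ball 0 1).inter ((convex_ball 0 1).linear_preimage (L.restrictScalars ℝ))
  · exact (L.toContinuousLinearMap.differentiable).differentiableOn
  · rw [hV]
    ext z
    constructor
    · rintro ⟨hz, hzr⟩
      refine ⟨r.removeNth z, ⟨fun j => hz _, ?_⟩, ?_⟩
      · rw [Set.mem_ofPred_eq, ← hzr]
        exact hz r
      · rw [← hzr, Fin.insertNth_self_removeNth]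
    · rintro ⟨w, ⟨hw, hLw⟩, rfl⟩
      refine ⟨fun j => ?_, by simp⟩
      rcases Fin.eq_self_or_eq_succAbove r j with rfl | ⟨i, rfl⟩
      · simpa using hLw
      · simpa using hw i

theorem isHolomorphicGraphInCoordinate_sumSurface (r : Fin 3) :
    IsHolomorphicGraphInCoordinate sumSurface r := by
  have key : ∀ (r : Fin 3) (a b : ℂ), (∀ z : Fin 3 → ℂ,
      z 2 = z 0 + z 1 ↔ z r = a * r.removeNth z 0 + b * r.removeNth z 1) →
      IsHolomorphicGraphInCoordinate sumSurface r := by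
    intro r a b h
    refine isHolomorphicGraphInCoordinate_of_linear
      (a • LinearMap.proj 0 + b • LinearMap.proj 1) ?_
    ext z
    simp [sumSurface, h z]
  fin_cases r
  · refine key 0 (-1) 1 fun z => ?_
    simp only [Fin.removeNth, Fin.zero_succAbove]
    constructor <;> intro h <;> grind
  · refine key 1 (-1) 1 fun z => ?_
    change z 2 = z 0 + z 1 ↔ z 1 = -1 * z 0 + 1 * z 2
    constructor <;> intro h <;> grind
  · refine key 2 1 1 fun z => ?_
    change z 2 = z 0 + z 1 ↔ z 2 = 1 * z 0 + 1 * z 1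
    simp

/-! ### Balanced disks in the images of the surface -/

theorem one_sub_star_mul_ne_zero {a ζ : ℂ} (ha : ‖a‖ < 1) (hζ : ‖ζ‖ ≤ 1) :
    1 - star a * ζ ≠ 0 := by
  intro h
  have h1 : ‖star a * ζ‖ = 1 := by rw [← sub_eq_zero.1 h, norm_one]
  rw [norm_mul, norm_star] at h1
  nlinarith [norm_nonneg a, norm_nonneg ζ]

theorem one_sub_star_mul_self_ne_zero {a : ℂ} (ha : ‖a‖ < 1) : 1 - star a * a ≠ 0 :=
  one_sub_star_mul_ne_zero ha ha.le

theorem moebiusInvolution_moebiusInvolution {a ζ : ℂ} (ha : ‖a‖ < 1) (hζ : ‖ζ‖ ≤ 1) :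
    moebiusInvolution a (moebiusInvolution a ζ) = ζ := by
  have h1 := one_sub_star_mul_ne_zero ha hζ
  have h2 := one_sub_star_mul_self_ne_zero ha
  have hnum : a - (a - ζ) / (1 - star a * ζ) = (1 - star a * a) * ζ / (1 - star a * ζ) := by
    rw [eq_div_iff h1, sub_mul, div_mul_cancel₀ _ h1]
    ring
  have hden : 1 - star a * ((a - ζ) / (1 - star a * ζ)) =
      (1 - star a * a) / (1 - star a * ζ) := by
    rw [eq_div_iff h1, sub_mul, mul_assoc, div_mul_cancel₀ _ h1]
    ring
  rw [moebiusInvolution, moebiusInvolution, hnum, hden, div_div_div_cancel_right₀ h1,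
    mul_div_cancel_left₀ _ h2]

/-- The partial fraction decomposition of the involution, with the summand regular at `0` chosen to
be the value `a` there. -/
theorem moebiusInvolution_eq_sub {a ζ : ℂ} (ha : ‖a‖ < 1) (hζ : ‖ζ‖ ≤ 1) :
    moebiusInvolution a ζ = a - (1 - star a * a) * ζ / (1 - star a * ζ) := by
  have h1 := one_sub_star_mul_ne_zero ha hζ
  rw [moebiusInvolution, eq_sub_iff_add_eq, ← add_div, div_eq_iff h1]
  ring

/-- If `α / (1 - aζ) + β / (1 - bζ) + γ / (1 - cζ)` vanishes near `0`, with all three numerators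
nonzero, then the three fractions have the same denominator. The hypothesis is this identity with
denominators cleared. -/
theorem eq_and_eq_of_sum_div_eq_zero {α β γ a b c : ℂ} (hα : α ≠ 0) (hβ : β ≠ 0) (hγ : γ ≠ 0)
    (h : ∀ ζ : ℂ, ‖ζ‖ < 1 → ζ ≠ 0 →
      α * ((1 - b * ζ) * (1 - c * ζ)) + β * ((1 - a * ζ) * (1 - c * ζ)) +
        γ * ((1 - a * ζ) * (1 - b * ζ)) = 0) : a = b ∧ a = c := by
  -- Three values determine the coefficients of a polynomial of degree at most two in `ζ`.
  have h1 := h (1 / 2) (by norm_num) (by norm_num)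
  have h2 := h (-1 / 2) (by norm_num) (by norm_num)
  have h3 := h (1 / 4) (by norm_num) (by norm_num)
  -- The reversed polynomial `t² p(1/t)` vanishes identically, so it may be evaluated at `a`, `b`
  -- and `c`.
  have hreverse : ∀ t : ℂ, α * ((t - b) * (t - c)) + β * ((t - a) * (t - c)) +
      γ * ((t - a) * (t - b)) = 0 := by
    intro t
    have e0 : α + β + γ = 0 := by
      linear_combination (-1 / 2) * h1 + (1 / 6) * h2 + (4 / 3) * h3
    have e1 : α * (b + c) + β * (a + c) + γ * (a + b) = 0 := by
      linear_combination h2 - h1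
    have e2 : α * (b * c) + β * (a * c) + γ * (a * b) = 0 := by
      linear_combination 2 * (h1 + h2) - 4 * e0
    linear_combination t ^ 2 * e0 - t * e1 + e2
  have ha := hreverse a
  have hb := hreverse b
  have hc := hreverse c
  have ha' : a = b ∨ a = c := by
    simpa [hα, sub_eq_zero] using ha
  have hb' : b = a ∨ b = c := by
    simpa [hβ, sub_eq_zero] using hb
  have hc' : c = a ∨ c = b := by
    simpa [hγ, sub_eq_zero] using hc
  grind

theorem moebiusInvolution_add_eq {x : Fin 3 → ℂ} (hx : x ∈ sumSurface) {ω η : ℂ}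
    (h : balancedDisk ω η ⊆ polydiskInvolution x '' sumSurface) {ζ : ℂ} (hζ : ‖ζ‖ < 1) :
    moebiusInvolution (x 2) (η * ζ) =
      moebiusInvolution (x 0) ζ + moebiusInvolution (x 1) (ω * ζ) := by
  obtain ⟨z, ⟨hz, hzsum⟩, hzx⟩ := h ⟨ζ, hζ, rfl⟩
  have hm : ∀ j, moebiusInvolution (x j) (![ζ, ω * ζ, η * ζ] j) = z j := fun j => by
    rw [← hzx]
    exact moebiusInvolution_moebiusInvolution (hx.1 j) (hz j).le
  have h0 := hm 0
  have h1 := hm 1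
  have h2 := hm 2
  simp only [Matrix.cons_val_zero, Matrix.cons_val_one, Matrix.cons_val] at h0 h1 h2
  rw [h0, h1, h2, hzsum]

/-- A balanced disk in the image of the surface is determined by `x` unless `x 0 = 0`: the poles of
the three Möbius maps along the disk have to coincide. -/
theorem eq_mul_of_balancedDisk_subset {x : Fin 3 → ℂ} (hx : x ∈ sumSurface) {ω η : ℂ}
    (hω : ‖ω‖ = 1) (hη : ‖η‖ = 1) (h : balancedDisk ω η ⊆ polydiskInvolution x '' sumSurface) :
    x 1 = ω * x 0 ∧ x 2 = η * x 0 := by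
  have hω0 : ω ≠ 0 := norm_ne_zero_iff.1 (by rw [hω]; exact one_ne_zero)
  have hη0 : η ≠ 0 := norm_ne_zero_iff.1 (by rw [hη]; exact one_ne_zero)
  have hpoles : star (x 0) = star (x 1) * ω ∧ star (x 0) = star (x 2) * η := by
    refine eq_and_eq_of_sum_div_eq_zero
      (one_sub_star_mul_self_ne_zero (hx.1 0))
      (mul_ne_zero (one_sub_star_mul_self_ne_zero (hx.1 1)) hω0)
      (neg_ne_zero.2 (mul_ne_zero (one_sub_star_mul_self_ne_zero (hx.1 2)) hη0)) ?_
    intro ζ hζ hζ0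
    have hωζ : ‖ω * ζ‖ ≤ 1 := by rw [norm_mul, hω, one_mul]; exact hζ.le
    have hηζ : ‖η * ζ‖ ≤ 1 := by rw [norm_mul, hη, one_mul]; exact hζ.le
    have hsum := moebiusInvolution_add_eq hx h hζ
    rw [moebiusInvolution_eq_sub (hx.1 0) hζ.le, moebiusInvolution_eq_sub (hx.1 1) hωζ,
      moebiusInvolution_eq_sub (hx.1 2) hηζ] at hsum
    have h0 := one_sub_star_mul_ne_zero (hx.1 0) hζ.le
    have h1 := one_sub_star_mul_ne_zero (hx.1 1) hωζ
    have h2 := one_sub_star_mul_ne_zero (hx.1 2) hηζ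
    have hfrac : (1 - star (x 0) * x 0) * ζ / (1 - star (x 0) * ζ) +
        (1 - star (x 1) * x 1) * (ω * ζ) / (1 - star (x 1) * (ω * ζ)) =
        (1 - star (x 2) * x 2) * (η * ζ) / (1 - star (x 2) * (η * ζ)) := by
      linear_combination hsum - hx.2
    rw [div_add_div _ _ h0 h1, div_eq_div_iff (mul_ne_zero h0 h1) h2] at hfrac
    refine mul_left_cancel₀ hζ0 ?_
    linear_combination hfrac
  have hconj : ∀ {y u : ℂ}, ‖u‖ = 1 → star (x 0) = star y * u → y = u * x 0 := by
    intro y u hu he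
    have huu : u * star u = 1 := by
      rw [← starRingEnd_apply, Complex.mul_conj, Complex.normSq_eq_norm_sq, hu]
      norm_num
    have h1 : x 0 = y * star u := by simpa [mul_comm] using congrArg star he
    rw [h1]
    linear_combination -y * huu
  exact ⟨hconj hω hpoles.1, hconj hη hpoles.2⟩

/-- At `x = 0` the involution is `z ↦ -z`, so every balanced disk in the plane `z₃ = z₁ + z₂` lies
in the image. -/
theorem balancedDisk_subset_image_zero {ω : ℂ} (hω : ‖ω‖ = 1) (hη : ‖1 + ω‖ = 1) :
    balancedDisk ω (1 + ω) ⊆ polydiskInvolution 0 '' sumSurface := by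
  rintro _ ⟨ζ, hζ, rfl⟩
  refine ⟨-![ζ, ω * ζ, (1 + ω) * ζ], ⟨?_, ?_⟩, ?_⟩
  · intro j
    fin_cases j <;> simp [hω, hη, hζ]
  · simp
    ring
  · ext j
    simp [polydiskInvolution, moebiusInvolution]

theorem hasTwoBalancedDisksAt_zero : HasTwoBalancedDisksAt sumSurface 0 := by
  have hnorm : ∀ s t : ℝ, s ^ 2 = 1 / 4 → t ^ 2 = 3 / 4 → ‖(⟨s, t⟩ : ℂ)‖ = 1 := by
    intro s t hs ht
    rw [← sq_eq_sq₀ (norm_nonneg _) zero_le_one, ← Complex.normSq_eq_norm_sq, Complex.normSq_mk]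
    linarith
  have hsq : (√3 / 2) ^ 2 = 3 / 4 := by
    rw [div_pow, Real.sq_sqrt (by norm_num)]
    norm_num
  have hω : ∀ t : ℝ, t ^ 2 = 3 / 4 → ‖(⟨-1 / 2, t⟩ : ℂ)‖ = 1 := fun t ht =>
    hnorm _ _ (by norm_num) ht
  have hη : ∀ t : ℝ, t ^ 2 = 3 / 4 → ‖(1 : ℂ) + ⟨-1 / 2, t⟩‖ = 1 := fun t ht => by
    have h1 : (1 : ℂ) + ⟨-1 / 2, t⟩ = ⟨1 / 2, t⟩ := by
      apply Complex.ext <;> norm_num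
    rw [h1]
    exact hnorm _ _ (by norm_num) ht
  have hsq' : (-(√3 / 2)) ^ 2 = 3 / 4 := by rw [neg_sq, hsq]
  -- The two primitive cube roots of unity `ω` are the unimodular `ω` with `‖1 + ω‖ = 1`.
  refine ⟨_, _, _, _, hω _ hsq, hη _ hsq, hω _ hsq', hη _ hsq', ?_,
    balancedDisk_subset_image_zero (hω _ hsq) (hη _ hsq),
    balancedDisk_subset_image_zero (hω _ hsq') (hη _ hsq')⟩
  intro h
  have him := congrArg (fun p : ℂ × ℂ => p.1.im) h
  have hpos : 0 < √3 := by positivity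
  simp only at him
  linarith

theorem mainTheorem7 :
    ¬ HasPolynomialExtensionProperty (unitPolydisk 3) sumSurface ∧
    (∀ r : Fin 3, IsHolomorphicGraphInCoordinate sumSurface r) ∧
    (∀ x ∈ sumSurface, HasTwoBalancedDisksAt sumSurface x ↔ x = 0) := by
  refine ⟨not_hasPolynomialExtensionProperty_sumSurface,
    isHolomorphicGraphInCoordinate_sumSurface, fun x hx => ⟨?_, ?_⟩⟩
  · rintro ⟨ω₁, η₁, ω₂, η₂, hω₁, hη₁, hω₂, hη₂, hne, h₁, h₂⟩
    obtain ⟨e₁, f₁⟩ := eq_mul_of_balancedDisk_subset hx hω₁ hη₁ h₁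
    obtain ⟨e₂, f₂⟩ := eq_mul_of_balancedDisk_subset hx hω₂ hη₂ h₂
    have hx0 : x 0 = 0 := by
      by_contra h0
      exact hne (Prod.ext (mul_right_cancel₀ h0 (e₁.symm.trans e₂))
        (mul_right_cancel₀ h0 (f₁.symm.trans f₂)))
    ext j
    fin_cases j
    · exact hx0
    · simp [e₁, hx0]
    · simp [f₁, hx0]
  · rintro rfl
    exact hasTwoBalancedDisksAt_zero
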